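/- Let $X\in\{1,2,3,4\}$ be the input of a broadcast channel $\mathfrak q(y,z|x)$ with two receivers. The output $Z\in\{1,2\}$ is deterministic: $Z=1$ if $X\in\{1,2\}$ and $Z=2$ if $X\in\{3,4\}$. The output $Y$ takes values in the six two-element subsets of $\{1,2,3,4\}$ and, given $X=x$, is uniformly distributed on the three subsets containing $x$. Thus, if $X$ has distribution $(a,b,c,d)$, then $Z$ has distribution $(a+b,c+d)$ and $Y$ has distribution $\frac13(a+b,a+c,a+d,b+c,b+d,c+d)$. For $\lambda\in[0,1]$ and a probability distribution $p(x)$ on $\{1,2,3,4\}$ define $$\lambda\text{-}SR(\mathfrak q,p(x))=\max_{p(u,v,w|x)}\bigl\{\lambda I(W;Y)+(1-\lambda)I(W;Z)+I(U;Y|W)+I(V;Z|W)-I(U;V|W)\bigr\},$$ where the maximum is over auxiliary random variables $U,V,W$ with arbitrary finite alphabets, the joint law is $p(x)\,p(u,v,w|x)\,\mathfrak q(y,z|x)$, and information is measured in bits (logarithms to base 2). Then, for every $\lambda\in[0,1]$: the maximum is attained for every $p(x)$; the function $p(x)\mapsto\lambda\text{-}SR(\mathfrak q,p(x))$ is concave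 on the simplex of probability distributions on $\{1,2,3,4\}$; it attains its maximum over this simplex at the uniform distribution $u(x)=\frac14$; and $$\lambda\text{-}SR(\mathfrak q,u(x))=\begin{cases}\frac53-\frac23\lambda,&\lambda\in[0,\frac12],\\ \frac43,&\lambda\in[\frac12,1].\end{cases}$$ -/

import Mathlib

namespace BC

noncomputable section

/-! ### Entropy and mutual information (in bits) of random variables on a finite space

`P : Ω → ℝ` is a probability mass function; random variables are functions on `Ω`. -/

/-- Law of the random variable `f` under `P`: `a ↦ P(f = a)`. -/
def law {Ω α : Type*} [Fintype Ω] [DecidableEq α] (P : Ω → ℝ) (f : Ω → α) (a : α) : ℝ :=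
  ∑ ω, if f ω = a then P ω else 0

/-- Shannon entropy `H(f)` in bits, with the convention `0 log 0 = 0`. -/
def entropy {Ω α : Type*} [Fintype Ω] [Fintype α] [DecidableEq α]
    (P : Ω → ℝ) (f : Ω → α) : ℝ :=
  -∑ a, law P f a * Real.logb 2 (law P f a)

/-- Conditional entropy `H(f | g) = H(f, g) - H(g)`. -/
def condEntropy {Ω α β : Type*} [Fintype Ω] [Fintype α] [DecidableEq α]
    [Fintype β] [DecidableEq β] (P : Ω → ℝ) (f : Ω → α) (g : Ω → β) : ℝ :=
  entropy P (fun ω => (f ω, g ω)) - entropy P g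

/-- Mutual information `I(f ; g) = H(f) - H(f | g)`. -/
def mutualInfo {Ω α β : Type*} [Fintype Ω] [Fintype α] [DecidableEq α]
    [Fintype β] [DecidableEq β] (P : Ω → ℝ) (f : Ω → α) (g : Ω → β) : ℝ :=
  entropy P f - condEntropy P f g

/-- Conditional mutual information `I(f ; g | h) = H(f | h) - H(f | g, h)`. -/
def condMutualInfo {Ω α β γ : Type*} [Fintype Ω] [Fintype α] [DecidableEq α]
    [Fintype β] [DecidableEq β] [Fintype γ] [DecidableEq γ]
    (P : Ω → ℝ) (f : Ω → α) (g : Ω → β) (h : Ω → γ) : ℝ :=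
  condEntropy P f h - condEntropy P f (fun ω => (g ω, h ω))

/-! ### Broadcast channels and the `λ`-sum rate -/

/-- A two-receiver discrete memoryless broadcast channel `q(y, z | x)` with finite alphabets. -/
structure BroadcastChannel (X Y Z : Type*) [Fintype Y] [Fintype Z] where
  /-- `prob x (y, z) = q(y, z | x)`. -/
  prob : X → Y × Z → ℝ
  prob_mem : ∀ x, prob x ∈ stdSimplex ℝ (Y × Z)

section SumRate

variable {X Y Z : Type*} [Fintype X] [DecidableEq X] [Fintype Y] [DecidableEq Y]
  [Fintype Z] [DecidableEq Z]

/-- Joint law `p(u, v, w, x) q(y, z | x)` of `(U, V, W, X, Y, Z)`. -/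
def jointLaw {U V W : Type*} (q : BroadcastChannel X Y Z) (r : U × V × W × X → ℝ) :
    U × V × W × X × Y × Z → ℝ :=
  fun (u, v, w, x, y, z) => r (u, v, w, x) * q.prob x (y, z)

/-- `λ I(W;Y) + (1 - λ) I(W;Z) + I(U;Y|W) + I(V;Z|W) - I(U;V|W)` for the joint input law
`r = p(u, v, w, x)`. -/
def sumRate {U V W : Type*} [Fintype U] [DecidableEq U] [Fintype V] [DecidableEq V]
    [Fintype W] [DecidableEq W] (q : BroadcastChannel X Y Z) (lam : ℝ)
    (r : U × V × W × X → ℝ) : ℝ :=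
  let P := jointLaw q r
  let rvU : U × V × W × X × Y × Z → U := fun (u, _, _, _, _, _) => u
  let rvV : U × V × W × X × Y × Z → V := fun (_, v, _, _, _, _) => v
  let rvW : U × V × W × X × Y × Z → W := fun (_, _, w, _, _, _) => w
  let rvY : U × V × W × X × Y × Z → Y := fun (_, _, _, _, y, _) => y
  let rvZ : U × V × W × X × Y × Z → Z := fun (_, _, _, _, _, z) => z
  lam * mutualInfo P rvW rvY + (1 - lam) * mutualInfo P rvW rvZ
    + condMutualInfo P rvU rvY rvW + condMutualInfo P rvV rvZ rvW
    - condMutualInfo P rvU rvV rvW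

/-- All values of the `λ`-sum rate over finite auxiliary alphabets of arbitrary sizes and
all joint laws `p(u, v, w, x)` whose `X`-marginal is `p`. -/
def sumRateValues (q : BroadcastChannel X Y Z) (lam : ℝ) (p : X → ℝ) : Set ℝ :=
  {s | ∃ (k l m : ℕ) (r : Fin k × Fin l × Fin m × X → ℝ),
      r ∈ stdSimplex ℝ (Fin k × Fin l × Fin m × X) ∧
      law r (fun (_, _, _, x) => x) = p ∧
      sumRate q lam r = s}

/-- `λ-SR(q, p(x))`, the maximum of `sumRateValues q lam p` (written as a supremum; that it is
attained is a separate assertion). -/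
def lambdaSR (q : BroadcastChannel X Y Z) (lam : ℝ) (p : X → ℝ) : ℝ :=
  sSup (sumRateValues q lam p)

end SumRate

/-! ### The channel -/

/-- The pair of inputs that are connected to each of the six outputs of receiver `Y`. -/
def inputPair : Fin 6 → Finset (Fin 4) :=
  ![{0, 1}, {0, 2}, {0, 3}, {1, 2}, {1, 3}, {2, 3}]

/-- The deterministic output at receiver `Z`: inputs `0, 1` give `0`, inputs `2, 3` give `1`. -/
def zOut : Fin 4 → Fin 2 := ![0, 0, 1, 1]

/-- The semi-deterministic channel: `Z = zOut X`, and `Y` is uniform on the three outputs whose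
input pair contains `X`. -/
def semiDetChannel : BroadcastChannel (Fin 4) (Fin 6) (Fin 2) where
  prob x := fun (y, z) => if x ∈ inputPair y ∧ z = zOut x then 1 / 3 else 0
  prob_mem x := by
    refine ⟨fun yz => ?_, ?_⟩
    · dsimp only
      split_ifs <;> norm_num
    · have h : ∀ x : Fin 4, (Finset.univ.filter
          (fun a : Fin 6 × Fin 2 => x ∈ inputPair a.1 ∧ a.2 = zOut x)).card = 3 := by
        decide
      rw [← Finset.sum_filter, Finset.sum_const, h]
      norm_num

/-- The uniform input distribution on the four inputs. -/
def uniformInput : Fin 4 → ℝ := fun _ => 1 / 4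

end

end BC

namespace BC

noncomputable section

/-! ### The function `x ↦ -x log₂ x` -/

/-! Expanding the informations splits the sum rate into `outputEntropy`, which depends on `p` alone,
plus one term `rateGivenW` for each value of `W` (`sumRate_eq`). Since `eta` satisfies a product
rule, these terms can be handled with unnormalised laws.

For one value of `W`, write H for entropies under the normalised conditional law. Submodularity of
entropy eliminates `V` and bounds the term by (1-λ)(H(Y) - H(Z)) + H(Z|U) - H(Y|U). The six outputs
of `Y` form three complementary pairings of the inputs, so H(Y) = log 3 + (h₁ + h₂ + h₃)/3, where h₁
= H(Z) and hᵢ is the binary entropy of the i-th pairing. Each pairing is the XOR of the other two,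
so h₁ ≤ h₂ + h₃. Hence H(Z|U) - H(Y|U) ≤ H(Z|U)/3 - log 3 ≤ H(Z)/3 - log 3, which gives `optRate`
(`rateGivenW_le`). Equality holds for `V = Z` and `U` independent of `Z` that names one input on
each side of `Z` (`exists_rateGivenW_eq`).

So the maximum over auxiliaries is `outputEntropy` plus the concave envelope of `optRate`.
Attainment follows from compactness of the hull of the graph, and concavity holds for each summand.
Both summands have explicit upper bounds, reached together at the uniform law with `W` constant or
`W = Z`. -/

/-- `eta x = -x log₂ x`, with `eta 0 = 0`. -/
def eta (x : ℝ) : ℝ := -(x * Real.logb 2 x)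

lemma eta_eq_negMulLog (x : ℝ) : eta x = Real.negMulLog x / Real.log 2 := by
  unfold eta Real.negMulLog Real.logb; ring

@[simp] lemma eta_zero : eta 0 = 0 := by simp [eta]

@[simp] lemma eta_one : eta 1 = 0 := by simp [eta]

/-- The product rule behind every rescaling of unnormalised laws; the convention at 0 makes it hold
without positivity assumptions. -/
lemma eta_mul (x y : ℝ) : eta (x * y) = x * eta y + y * eta x := by
  by_cases hx : x = 0
  · simp [hx]
  by_cases hy : y = 0
  · simp [hy]
  unfold eta
  rw [Real.logb_mul hx hy]
  ring

lemma eta_one_third : eta (1 / 3) = Real.logb 2 3 / 3 := by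
  unfold eta
  rw [one_div, Real.logb_inv]
  ring

lemma eta_one_half : eta (1 / 2) = 1 / 2 := by
  unfold eta
  rw [one_div, Real.logb_inv, Real.logb_self_eq_one (by norm_num)]
  ring

lemma continuous_eta : Continuous eta := by
  have : eta = fun x => Real.negMulLog x / Real.log 2 := funext eta_eq_negMulLog
  rw [this]
  exact Real.continuous_negMulLog.div_const _

lemma concaveOn_eta : ConcaveOn ℝ (Set.Ici 0) eta := by
  have : eta = fun x => (Real.log 2)⁻¹ • Real.negMulLog x := by
    funext x; rw [eta_eq_negMulLog, smul_eq_mul]; ring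
  rw [this]
  exact Real.concaveOn_negMulLog.smul (inv_nonneg.2 (Real.log_nonneg one_le_two))

lemma entropy_eq_sum_eta {Ω α : Type*} [Fintype Ω] [Fintype α] [DecidableEq α]
    (P : Ω → ℝ) (f : Ω → α) : entropy P f = ∑ a, eta (law P f a) := by
  simp [entropy, eta]

/-! ### Entropy inequalities for unnormalised distributions -/

/-- Merging outcomes does not increase the entropy. -/
lemma eta_sum_le {ι : Type*} (s : Finset ι) (f : ι → ℝ) (hf : ∀ i ∈ s, 0 ≤ f i) :
    eta (∑ i ∈ s, f i) ≤ ∑ i ∈ s, eta (f i) := by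
  have : eta (∑ i ∈ s, f i) = ∑ i ∈ s, -(f i * Real.logb 2 (∑ j ∈ s, f j)) := by
    rw [Finset.sum_neg_distrib, ← Finset.sum_mul, eta]
  rw [this]
  refine Finset.sum_le_sum fun i hi => ?_
  rcases (hf i hi).eq_or_lt with h | h
  · simp [← h]
  · unfold eta
    have := Real.logb_le_logb_of_le one_lt_two h (Finset.single_le_sum hf hi)
    nlinarith

/-- This is `log t ≤ t - 1` at `t = y / x`, the termwise form of nonnegativity of relative entropy.
-/
lemma mul_log_div_ge {x y : ℝ} (hx : 0 ≤ x) (hy : 0 ≤ y) (h : y = 0 → x = 0) :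
    x - y ≤ x * (Real.log x - Real.log y) := by
  rcases hx.eq_or_lt with h0 | h0
  · simpa [← h0] using hy
  have hy' : 0 < y := hy.lt_of_ne fun h' => h0.ne' (h h'.symm)
  have := Real.log_le_sub_one_of_pos (div_pos hy' h0)
  rw [Real.log_div hy'.ne' h0.ne'] at this
  have h2 : x * (Real.log y - Real.log x) ≤ x * (y / x - 1) := by gcongr
  have h3 : x * (y / x - 1) = y - x := by field_simp
  linarith

/-- Subadditivity of entropy, for an unnormalised joint distribution. -/
lemma sum_eta_add_eta_le {α β : Type*} [Fintype α] [Fintype β] (f : α → β → ℝ)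
    (hf : ∀ a b, 0 ≤ f a b) :
    ∑ a, ∑ b, eta (f a b) + eta (∑ a, ∑ b, f a b)
      ≤ ∑ a, eta (∑ b, f a b) + ∑ b, eta (∑ a, f a b) := by
  set T := ∑ a, ∑ b, f a b with hT
  set R : α → ℝ := fun a => ∑ b, f a b with hR
  set C : β → ℝ := fun b => ∑ a, f a b with hC
  have hR0 : ∀ a, 0 ≤ R a := fun a => Finset.sum_nonneg fun b _ => hf a b
  have hC0 : ∀ b, 0 ≤ C b := fun b => Finset.sum_nonneg fun a _ => hf a b
  have hT0 : 0 ≤ T := Finset.sum_nonneg fun a _ => hR0 a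
  have hTC : T = ∑ b, C b := Finset.sum_comm
  rcases hT0.eq_or_lt with h0 | hpos
  · have hR1 : ∀ a, R a = 0 := fun a =>
      (Finset.sum_eq_zero_iff_of_nonneg fun a _ => hR0 a).1 h0.symm a (Finset.mem_univ _)
    have h1 : ∀ a b, f a b = 0 := fun a b =>
      (Finset.sum_eq_zero_iff_of_nonneg fun b _ => hf a b).1 (hR1 a) b (Finset.mem_univ _)
    simp [h1, ← h0]
  have hfR : ∀ a b, f a b ≤ R a := fun a b =>
    Finset.single_le_sum (fun b _ => hf a b) (Finset.mem_univ b)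
  have hfC : ∀ a b, f a b ≤ C b := fun a b =>
    Finset.single_le_sum (f := fun a => f a b) (fun a _ => hf a b) (Finset.mem_univ a)
  -- Comparison of the joint law with the product of its marginals, rescaled to total mass `T`; the
  -- left side sums to zero.
  have key : ∀ a b, f a b - R a * C b / T ≤
      f a b * Real.log (f a b) + f a b * Real.log T - f a b * Real.log (R a)
        - f a b * Real.log (C b) := by
    intro a b
    rcases (hf a b).eq_or_lt with h | h
    · rw [← h]
      have : 0 ≤ R a * C b / T := by have := hR0 a; have := hC0 b; positivity
      simpa using this
    · have hRp := h.trans_le (hfR a b)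
      have hCp := h.trans_le (hfC a b)
      have := mul_log_div_ge h.le (y := R a * C b / T) (by positivity)
        (fun h' => absurd h' (by positivity))
      rw [Real.log_div (by positivity) hpos.ne', Real.log_mul hRp.ne' hCp.ne'] at this
      linarith
  have hsum := Finset.sum_le_sum fun a (_ : a ∈ Finset.univ) =>
    Finset.sum_le_sum fun b (_ : b ∈ Finset.univ) => key a b
  have hl : ∑ a, ∑ b, (f a b - R a * C b / T) = 0 := by
    simp only [Finset.sum_sub_distrib]
    have : ∑ a, ∑ b, R a * C b / T = T := by
      simp only [← Finset.sum_div, ← Finset.mul_sum, ← hTC, ← Finset.sum_mul]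
      rw [show ∑ a, R a = T from rfl]
      field_simp
    rw [this]; exact sub_self T
  have hr : ∑ a, ∑ b, (f a b * Real.log (f a b) + f a b * Real.log T - f a b * Real.log (R a)
      - f a b * Real.log (C b)) = ∑ a, ∑ b, f a b * Real.log (f a b) + T * Real.log T
        - ∑ a, R a * Real.log (R a) - ∑ b, C b * Real.log (C b) := by
    simp only [Finset.sum_sub_distrib, Finset.sum_add_distrib]
    rw [Finset.sum_comm (f := fun a b => f a b * Real.log (C b))]
    simp only [← Finset.sum_mul, hR, hC, hT]
  rw [hl, hr] at hsum
  simp only [eta_eq_negMulLog, Real.negMulLog, ← Finset.sum_div, ← add_div]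
  have hlog := Real.log_pos one_lt_two
  refine div_le_div_of_nonneg_right ?_ hlog.le
  simp only [neg_mul, Finset.sum_neg_distrib]
  simp only [hR, hC] at hsum
  linarith

/-! ### Compactness of convex hulls -/

/-- In a finite-dimensional space the convex hull of a compact set is compact. -/
lemma isCompact_convexHull_of_finiteDimensional {E : Type} [NormedAddCommGroup E]
    [NormedSpace ℝ E] [FiniteDimensional ℝ E] {s : Set E} (hs : IsCompact s) :
    IsCompact (convexHull ℝ s) := by
  rcases s.eq_empty_or_nonempty with rfl | ⟨e₀, he₀⟩
  · simp
  set n := Module.finrank ℝ E + 1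
  have hK : IsCompact (stdSimplex ℝ (Fin n) ×ˢ (Set.univ.pi fun _ : Fin n => s)) :=
    (isCompact_stdSimplex ℝ (Fin n)).prod (isCompact_univ_pi fun _ => hs)
  have hcont : Continuous fun c : (Fin n → ℝ) × (Fin n → E) => ∑ i, c.1 i • c.2 i := by fun_prop
  convert hK.image hcont using 1
  ext x
  constructor
  · intro hx
    obtain ⟨ι, _, z, w, hz, hind, hw, hw1, hx⟩ := eq_pos_convex_span_of_mem_convexHull hx
    have hcard : Fintype.card ι ≤ Fintype.card (Fin n) := by
      rw [Fintype.card_fin]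
      exact hind.card_le_finrank_succ.trans (Nat.add_le_add_right (Submodule.finrank_le _) 1)
    obtain ⟨φ⟩ := Function.Embedding.nonempty_of_card_le hcard
    -- Carathéodory leaves at most `n` points; the unused slots get weight 0 and the dummy point
    -- `e₀`, so that a single compact parameter space covers the hull.
    refine ⟨(Function.extend φ w 0, Function.extend φ z fun _ => e₀), ⟨⟨fun j => ?_, ?_⟩, ?_⟩, ?_⟩
    · by_cases hj : ∃ i, φ i = j
      · obtain ⟨i, rfl⟩ := hj
        simpa [φ.injective.extend_apply] using (hw i).le
      · simp [Function.extend_apply' _ _ _ hj]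
    · rw [← hw1]
      exact (Fintype.sum_of_injective φ φ.injective _ _
        (fun j hj => by simp [Function.extend_apply' _ _ _ (by simpa using hj)])
        (fun i => by simp [φ.injective.extend_apply])).symm
    · intro j _
      by_cases hj : ∃ i, φ i = j
      · obtain ⟨i, rfl⟩ := hj
        simpa [φ.injective.extend_apply] using hz ⟨i, rfl⟩
      · simpa [Function.extend_apply' _ _ _ hj] using he₀
    · rw [← hx]
      exact (Fintype.sum_of_injective φ φ.injective _ _
        (fun j hj => by simp [Function.extend_apply' _ _ _ (by simpa using hj)])
        (fun i => by simp [φ.injective.extend_apply])).symm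
  · rintro ⟨⟨w, z⟩, ⟨⟨hw0, hw1⟩, hz⟩, rfl⟩
    exact mem_convexHull_of_exists_fintype w z hw0 hw1 (fun i => hz i trivial) rfl

/-! ### Output laws of the channel -/

/-- Law of the output `Y` for the (unnormalised) input law `μ`. -/
def outY (μ : Fin 4 → ℝ) (y : Fin 6) : ℝ := ∑ x, if x ∈ inputPair y then μ x / 3 else 0

/-- Law of the output `Z` for the (unnormalised) input law `μ`. -/
def outZ (μ : Fin 4 → ℝ) (z : Fin 2) : ℝ := ∑ x, if z = zOut x then μ x else 0

lemma sum_eta_outZ (μ : Fin 4 → ℝ) :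
    ∑ z, eta (outZ μ z) = eta (μ 0 + μ 1) + eta (μ 2 + μ 3) := by
  simp [outZ, zOut, Fin.sum_univ_four]

/-- The six outputs are grouped into the three complementary pairings of the inputs; the first
pairing is `Z`. -/
lemma sum_eta_outY (μ : Fin 4 → ℝ) :
    ∑ y, eta (outY μ y) = (eta (μ 0 + μ 1) + eta (μ 2 + μ 3) + eta (μ 0 + μ 2) + eta (μ 1 + μ 3)
      + eta (μ 0 + μ 3) + eta (μ 1 + μ 2)) / 3 + Real.logb 2 3 * ∑ x, μ x := by
  have h : ∀ x, eta (x / 3) = eta x / 3 + x * (Real.logb 2 3 / 3) := fun x => by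
    rw [div_eq_mul_one_div, eta_mul, eta_one_third]; ring
  simp [outY, inputPair, Fin.sum_univ_four, Fin.sum_univ_six, ← add_div, h]
  ring

lemma sum_outZ (μ : Fin 4 → ℝ) : ∑ z, outZ μ z = ∑ x, μ x := by
  simp [outZ, zOut, Fin.sum_univ_four, add_assoc]

/-! ### Splitting the sum rate over the values of `W` -/

section Decomposition

set_option linter.unusedSectionVars false

variable {U V W : Type*} [Fintype U] [DecidableEq U] [Fintype V] [DecidableEq V]
  [Fintype W] [DecidableEq W]

/-- The contribution of `W = w` to the conditional part of the `λ`-sum rate, where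
`m u v x = P(U = u, V = v, W = w, X = x)`. -/
def rateGivenW (lam : ℝ) (m : U → V → Fin 4 → ℝ) : ℝ :=
  (1 - lam) * ∑ y, eta (outY (fun x => ∑ u, ∑ v, m u v x) y)
    + lam * ∑ z, eta (outZ (fun x => ∑ u, ∑ v, m u v x) z)
    - ∑ u, ∑ y, eta (outY (fun x => ∑ v, m u v x) y)
    - ∑ v, ∑ z, eta (outZ (fun x => ∑ u, m u v x) z)
    + ∑ u, ∑ v, eta (∑ x, m u v x)

/-- `λ H(Y) + (1 - λ) H(Z)` for the input law `p`. -/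
def outputEntropy (lam : ℝ) (p : Fin 4 → ℝ) : ℝ :=
  lam * ∑ y, eta (outY p y) + (1 - lam) * ∑ z, eta (outZ p z)

lemma semiDetChannel_sum_z (x : Fin 4) (y : Fin 6) :
    ∑ z, semiDetChannel.prob x (y, z) = if x ∈ inputPair y then 1 / 3 else 0 := by
  simp [semiDetChannel, ite_and]

lemma semiDetChannel_sum_y (x : Fin 4) (z : Fin 2) :
    ∑ y, semiDetChannel.prob x (y, z) = if z = zOut x then 1 else 0 := by
  have h : ∀ x : Fin 4, (Finset.univ.filter (fun y => x ∈ inputPair y)).card = 3 := by decide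
  by_cases hz : z = zOut x <;> simp [semiDetChannel, hz, Finset.sum_ite, h]

lemma semiDetChannel_sum (x : Fin 4) : ∑ y, ∑ z, semiDetChannel.prob x (y, z) = 1 := by
  rw [← Fintype.sum_prod_type]; exact (semiDetChannel.prob_mem x).2

variable (r : U × V × W × Fin 4 → ℝ)

lemma sum_mul_prob_y (f : Fin 4 → ℝ) (y : Fin 6) :
    ∑ x, ∑ z, f x * semiDetChannel.prob x (y, z) = outY f y := by
  simp only [← Finset.mul_sum, semiDetChannel_sum_z, outY]
  exact Finset.sum_congr rfl fun x _ => by split_ifs <;> ring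

lemma sum_mul_prob_z (f : Fin 4 → ℝ) (z : Fin 2) :
    ∑ x, ∑ y, f x * semiDetChannel.prob x (y, z) = outZ f z := by
  simp only [← Finset.mul_sum, semiDetChannel_sum_y, outZ]
  exact Finset.sum_congr rfl fun x _ => by split_ifs <;> ring

lemma sum_mul_prob (f : Fin 4 → ℝ) :
    ∑ x, ∑ y, ∑ z, f x * semiDetChannel.prob x (y, z) = ∑ x, f x := by
  simp only [← Finset.mul_sum, semiDetChannel_sum, mul_one]

lemma outY_sum {ι : Type*} (s : Finset ι) (f : ι → Fin 4 → ℝ) (y : Fin 6) :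
    outY (fun x => ∑ i ∈ s, f i x) y = ∑ i ∈ s, outY (f i) y := by
  simp only [outY, Finset.sum_div]
  rw [Finset.sum_comm]
  exact Finset.sum_congr rfl fun x _ => by split_ifs <;> simp

lemma outZ_sum {ι : Type*} (s : Finset ι) (f : ι → Fin 4 → ℝ) (z : Fin 2) :
    outZ (fun x => ∑ i ∈ s, f i x) z = ∑ i ∈ s, outZ (f i) z := by
  simp only [outZ]
  rw [Finset.sum_comm]
  exact Finset.sum_congr rfl fun x _ => by split_ifs <;> simp

lemma law_X : law r (fun ω => ω.2.2.2) = fun x => ∑ u, ∑ v, ∑ w, r (u, v, w, x) := by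
  funext x
  simp only [law, Fintype.sum_prod_type, Finset.sum_ite_eq', Finset.mem_univ, if_true]

lemma entropy_Y :
    entropy (jointLaw semiDetChannel r) (fun ω => ω.2.2.2.2.1)
      = ∑ y, eta (outY (law r fun ω => ω.2.2.2) y) := by
  have : ∀ (y : Fin 6), law (jointLaw semiDetChannel r)
      (fun ω => ω.2.2.2.2.1) y = outY (law r fun ω => ω.2.2.2) y := by
    intros
    simp only [law_X, outY_sum]
    simp only [← sum_mul_prob_y]
    simp only [law, jointLaw, Fintype.sum_prod_type, 
      Finset.sum_ite_irrel, Finset.sum_const_zero, Finset.sum_ite_eq', Finset.mem_univ, if_true]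
  rw [entropy_eq_sum_eta]
  simp only [this]

lemma entropy_Z :
    entropy (jointLaw semiDetChannel r) (fun ω => ω.2.2.2.2.2)
      = ∑ z, eta (outZ (law r fun ω => ω.2.2.2) z) := by
  have : ∀ (z : Fin 2), law (jointLaw semiDetChannel r)
      (fun ω => ω.2.2.2.2.2) z = outZ (law r fun ω => ω.2.2.2) z := by
    intros
    simp only [law_X, outZ_sum]
    simp only [← sum_mul_prob_z]
    simp only [law, jointLaw, Fintype.sum_prod_type, 
      Finset.sum_ite_eq', Finset.mem_univ, if_true]
  rw [entropy_eq_sum_eta]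
  simp only [this]

lemma entropy_WY :
    entropy (jointLaw semiDetChannel r) (fun ω => (ω.2.2.1, ω.2.2.2.2.1))
      = ∑ w, ∑ y, eta (outY (fun x => ∑ u, ∑ v, r (u, v, w, x)) y) := by
  have : ∀ (w : W) (y : Fin 6), law (jointLaw semiDetChannel r)
      (fun ω => (ω.2.2.1, ω.2.2.2.2.1)) (w, y) = outY (fun x => ∑ u, ∑ v, r (u, v, w, x)) y := by
    intros
    simp only [outY_sum]
    simp only [← sum_mul_prob_y]
    simp only [law, jointLaw, Fintype.sum_prod_type, Prod.mk.injEq, ite_and,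
      Finset.sum_ite_irrel, Finset.sum_const_zero, Finset.sum_ite_eq', Finset.mem_univ, if_true]
  rw [entropy_eq_sum_eta]
  simp only [Fintype.sum_prod_type, this]

lemma entropy_YW :
    entropy (jointLaw semiDetChannel r) (fun ω => (ω.2.2.2.2.1, ω.2.2.1))
      = ∑ w, ∑ y, eta (outY (fun x => ∑ u, ∑ v, r (u, v, w, x)) y) := by
  have : ∀ (y : Fin 6) (w : W), law (jointLaw semiDetChannel r)
      (fun ω => (ω.2.2.2.2.1, ω.2.2.1)) (y, w) = outY (fun x => ∑ u, ∑ v, r (u, v, w, x)) y := by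
    intros
    simp only [outY_sum]
    simp only [← sum_mul_prob_y]
    simp only [law, jointLaw, Fintype.sum_prod_type, Prod.mk.injEq, ite_and,
      Finset.sum_ite_irrel, Finset.sum_const_zero, Finset.sum_ite_eq', Finset.mem_univ, if_true]
  rw [entropy_eq_sum_eta]
  simp only [Fintype.sum_prod_type, this]
  exact Finset.sum_comm

lemma entropy_WZ :
    entropy (jointLaw semiDetChannel r) (fun ω => (ω.2.2.1, ω.2.2.2.2.2))
      = ∑ w, ∑ z, eta (outZ (fun x => ∑ u, ∑ v, r (u, v, w, x)) z) := by
  have : ∀ (w : W) (z : Fin 2), law (jointLaw semiDetChannel r)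
      (fun ω => (ω.2.2.1, ω.2.2.2.2.2)) (w, z) = outZ (fun x => ∑ u, ∑ v, r (u, v, w, x)) z := by
    intros
    simp only [outZ_sum]
    simp only [← sum_mul_prob_z]
    simp only [law, jointLaw, Fintype.sum_prod_type, Prod.mk.injEq, ite_and,
      Finset.sum_ite_irrel, Finset.sum_const_zero, Finset.sum_ite_eq', Finset.mem_univ, if_true]
  rw [entropy_eq_sum_eta]
  simp only [Fintype.sum_prod_type, this]

lemma entropy_ZW :
    entropy (jointLaw semiDetChannel r) (fun ω => (ω.2.2.2.2.2, ω.2.2.1))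
      = ∑ w, ∑ z, eta (outZ (fun x => ∑ u, ∑ v, r (u, v, w, x)) z) := by
  have : ∀ (z : Fin 2) (w : W), law (jointLaw semiDetChannel r)
      (fun ω => (ω.2.2.2.2.2, ω.2.2.1)) (z, w) = outZ (fun x => ∑ u, ∑ v, r (u, v, w, x)) z := by
    intros
    simp only [outZ_sum]
    simp only [← sum_mul_prob_z]
    simp only [law, jointLaw, Fintype.sum_prod_type, Prod.mk.injEq, ite_and,
      Finset.sum_ite_irrel, Finset.sum_const_zero, Finset.sum_ite_eq', Finset.mem_univ, if_true]
  rw [entropy_eq_sum_eta]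
  simp only [Fintype.sum_prod_type, this]
  exact Finset.sum_comm

lemma entropy_UYW :
    entropy (jointLaw semiDetChannel r) (fun ω => (ω.1, ω.2.2.2.2.1, ω.2.2.1))
      = ∑ w, ∑ u, ∑ y, eta (outY (fun x => ∑ v, r (u, v, w, x)) y) := by
  have : ∀ (u : U) (y : Fin 6) (w : W), law (jointLaw semiDetChannel r)
      (fun ω => (ω.1, ω.2.2.2.2.1, ω.2.2.1)) (u, y, w) = outY (fun x => ∑ v, r (u, v, w, x)) y := by
    intros
    simp only [outY_sum]
    simp only [← sum_mul_prob_y]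
    simp only [law, jointLaw, Fintype.sum_prod_type, Prod.mk.injEq, ite_and,
      Finset.sum_ite_irrel, Finset.sum_const_zero, Finset.sum_ite_eq', Finset.mem_univ, if_true]
  rw [entropy_eq_sum_eta]
  simp only [Fintype.sum_prod_type, this]
  rw [Finset.sum_comm_cycle]

lemma entropy_VZW :
    entropy (jointLaw semiDetChannel r) (fun ω => (ω.2.1, ω.2.2.2.2.2, ω.2.2.1))
      = ∑ w, ∑ v, ∑ z, eta (outZ (fun x => ∑ u, r (u, v, w, x)) z) := by
  have : ∀ (v : V) (z : Fin 2) (w : W), law (jointLaw semiDetChannel r)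
      (fun ω => (ω.2.1, ω.2.2.2.2.2, ω.2.2.1)) (v, z, w) = outZ (fun x => ∑ u, r (u, v, w, x)) z := by
    intros
    simp only [outZ_sum]
    simp only [← sum_mul_prob_z]
    simp only [law, jointLaw, Fintype.sum_prod_type, Prod.mk.injEq, ite_and,
      Finset.sum_ite_irrel, Finset.sum_const_zero, Finset.sum_ite_eq', Finset.mem_univ, if_true]
  rw [entropy_eq_sum_eta]
  simp only [Fintype.sum_prod_type, this]
  rw [Finset.sum_comm_cycle]

lemma entropy_UVW :
    entropy (jointLaw semiDetChannel r) (fun ω => (ω.1, ω.2.1, ω.2.2.1))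
      = ∑ w, ∑ u, ∑ v, eta (∑ x, r (u, v, w, x)) := by
  have : ∀ (u : U) (v : V) (w : W), law (jointLaw semiDetChannel r)
      (fun ω => (ω.1, ω.2.1, ω.2.2.1)) (u, v, w) = ∑ x, r (u, v, w, x) := by
    intro u v w
    rw [← sum_mul_prob fun x => r (u, v, w, x)]
    simp only [law, jointLaw, Fintype.sum_prod_type, Prod.mk.injEq, ite_and,
      Finset.sum_ite_irrel, Finset.sum_const_zero, Finset.sum_ite_eq', Finset.mem_univ, if_true]
  rw [entropy_eq_sum_eta]
  simp only [Fintype.sum_prod_type, this]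
  rw [Finset.sum_comm_cycle]

/-- The `λ`-sum rate is the output entropy plus the contributions of the values of `W`. -/
lemma sumRate_eq (lam : ℝ) :
    sumRate semiDetChannel lam r = outputEntropy lam (law r fun ω => ω.2.2.2)
      + ∑ w, rateGivenW lam fun u v x => r (u, v, w, x) := by
  simp only [sumRate, mutualInfo, condMutualInfo, condEntropy, outputEntropy, rateGivenW,
    entropy_Y, entropy_Z, entropy_WY, entropy_YW, entropy_WZ, entropy_ZW, entropy_UYW,
    entropy_VZW, entropy_UVW, Finset.sum_add_distrib, Finset.sum_sub_distrib, ← Finset.mul_sum]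
  ring

end Decomposition

/-! ### The optimal rate for a given conditional input law -/

/-- The best contribution to the conditional part of the `λ`-sum rate of a value of `W` with
(unnormalised) conditional input law `μ`. -/
def optRate (lam : ℝ) (μ : Fin 4 → ℝ) : ℝ :=
  (1 - lam) * (∑ y, eta (outY μ y) - ∑ z, eta (outZ μ z))
    + (∑ z, eta (outZ μ z) - eta (∑ x, μ x)) / 3 - Real.logb 2 3 * ∑ x, μ x

lemma outZ_nonneg {μ : Fin 4 → ℝ} (hμ : ∀ x, 0 ≤ μ x) (z : Fin 2) : 0 ≤ outZ μ z :=
  Finset.sum_nonneg fun x _ => by split_ifs; exacts [hμ x, le_rfl]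

lemma outY_nonneg {μ : Fin 4 → ℝ} (hμ : ∀ x, 0 ≤ μ x) (y : Fin 6) : 0 ≤ outY μ y :=
  Finset.sum_nonneg fun x _ => by split_ifs; exacts [div_nonneg (hμ x) (by norm_num), le_rfl]

/-- The sum modulo two of two bits has at most the sum of their entropies. -/
lemma eta_xor_le {a b c d : ℝ} (ha : 0 ≤ a) (hb : 0 ≤ b) (hc : 0 ≤ c) (hd : 0 ≤ d) :
    eta (a + b) + eta (c + d) + eta (a + b + c + d)
      ≤ eta (a + c) + eta (b + d) + (eta (a + d) + eta (b + c)) := by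
  -- In this 2×2 table the rows and the columns carry the two bits, and the two diagonals `{a, b}`
  -- and `{c, d}` carry their sum modulo two.
  have h1 := sum_eta_add_eta_le ![![a, c], ![d, b]] (by
    intro i j; fin_cases i <;> fin_cases j <;> assumption)
  have h2 := eta_sum_le Finset.univ ![a, b] (by intro i _; fin_cases i <;> assumption)
  have h3 := eta_sum_le Finset.univ ![c, d] (by intro i _; fin_cases i <;> assumption)
  simp [Fin.sum_univ_two] at h1 h2 h3
  rw [show a + b + c + d = a + c + (d + b) by ring, add_comm b d, add_comm b c]
  linarith

/-- After the pairing expansion of `Y`, only the XOR inequality h₁ ≤ h₂ + h₃ remains. -/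
lemma sum_eta_outZ_sub_outY_le {μ : Fin 4 → ℝ} (hμ : ∀ x, 0 ≤ μ x) :
    ∑ z, eta (outZ μ z) - ∑ y, eta (outY μ y)
      ≤ (∑ z, eta (outZ μ z) - eta (∑ x, μ x)) / 3 - Real.logb 2 3 * ∑ x, μ x := by
  have := eta_xor_le (hμ 0) (hμ 1) (hμ 2) (hμ 3)
  rw [sum_eta_outZ, sum_eta_outY, Fin.sum_univ_four]
  linarith

/-- Four inequalities are added: H(U,V) ≤ H(U,V,Z), I(U;V|Z) ≥ 0, the channel inequality applied for
each `u`, and I(U;Z) ≥ 0, the last with weight 1/3. -/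
lemma rateGivenW_le {U V : Type*} [Fintype U] [Fintype V] (lam : ℝ) (m : U → V → Fin 4 → ℝ)
    (hm : ∀ u v x, 0 ≤ m u v x) :
    rateGivenW lam m ≤ optRate lam fun x => ∑ u, ∑ v, m u v x := by
  set μ : Fin 4 → ℝ := fun x => ∑ u, ∑ v, m u v x with hμ
  set ν : U → Fin 4 → ℝ := fun u x => ∑ v, m u v x with hν
  have hν0 : ∀ u x, 0 ≤ ν u x := fun u x => Finset.sum_nonneg fun v _ => hm u v x
  have h1 : ∑ u, ∑ v, eta (∑ x, m u v x) ≤ ∑ u, ∑ v, ∑ z, eta (outZ (m u v) z) := by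
    refine Finset.sum_le_sum fun u _ => Finset.sum_le_sum fun v _ => ?_
    rw [← sum_outZ]
    exact eta_sum_le _ _ fun z _ => outZ_nonneg (hm u v) z
  have h2 : ∑ u, ∑ v, ∑ z, eta (outZ (m u v) z) + ∑ z, eta (outZ μ z)
      ≤ ∑ u, ∑ z, eta (outZ (ν u) z) + ∑ v, ∑ z, eta (outZ (fun x => ∑ u, m u v x) z) := by
    have h := Finset.sum_le_sum fun z (_ : z ∈ Finset.univ) =>
      sum_eta_add_eta_le (fun u v => outZ (m u v) z) fun u v => outZ_nonneg (hm u v) z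
    simp only [Finset.sum_add_distrib, ← outZ_sum] at h
    rw [Finset.sum_comm (f := fun u z => eta (outZ (ν u) z)),
      Finset.sum_comm (f := fun v z => eta (outZ (fun x => ∑ u, m u v x) z)),
      Finset.sum_comm_cycle (f := fun u v z => eta (outZ (m u v) z))]
    exact h
  have h3 : ∑ u, ∑ z, eta (outZ (ν u) z) - ∑ u, ∑ y, eta (outY (ν u) y)
      ≤ (∑ u, ∑ z, eta (outZ (ν u) z) - ∑ u, eta (∑ x, ν u x)) / 3
        - Real.logb 2 3 * ∑ u, ∑ x, ν u x := by
    rw [← Finset.sum_sub_distrib, ← Finset.sum_sub_distrib, Finset.sum_div, Finset.mul_sum,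
      ← Finset.sum_sub_distrib]
    exact Finset.sum_le_sum fun u _ => sum_eta_outZ_sub_outY_le (hν0 u)
  have h5 : ∑ u, ∑ x, ν u x = ∑ x, μ x := Finset.sum_comm
  have h4 : ∑ u, ∑ z, eta (outZ (ν u) z) + eta (∑ x, μ x)
      ≤ ∑ u, eta (∑ x, ν u x) + ∑ z, eta (outZ μ z) := by
    have h := sum_eta_add_eta_le (fun u z => outZ (ν u) z) fun u z => outZ_nonneg (hν0 u) z
    simp only [← outZ_sum, sum_outZ] at h
    rwa [h5] at h
  rw [h5] at h3
  unfold rateGivenW optRate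
  linarith

/-- Product law of two bits with parameters `α` and `γ`. -/
def crossWeight (α γ : ℝ) : Fin 4 → ℝ :=
  ![α * γ, α * (1 - γ), (1 - α) * γ, (1 - α) * (1 - γ)]

/-- Unnormalised law of `(U, V, X)` for which, given `U`, the input takes one of two values on
different sides of `Z`, and `V = Z`. -/
def crossLaw (α γ s t : ℝ) (u : Fin 4) (v : Fin 2) (x : Fin 4) : ℝ :=
  crossWeight α γ u *
    if v = 0 then (if x = ![0, 0, 1, 1] u then s else 0)
    else (if x = ![2, 3, 2, 3] u then t else 0)

lemma sum_crossLaw (α γ s t : ℝ) (x : Fin 4) :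
    ∑ u, ∑ v, crossLaw α γ s t u v x
      = ![α * s, (1 - α) * s, γ * t, (1 - γ) * t] x := by
  fin_cases x <;> simp [crossLaw, crossWeight, Fin.sum_univ_four, Fin.sum_univ_two] <;> ring

/-- All inequalities in `rateGivenW_le` are tight here: `Z` is a function of `V`, `U` is independent
of `Z`, and, given `U`, one of the other two pairings is constant while the remaining one separates
the same inputs as `Z`. -/
lemma rateGivenW_crossLaw (lam α γ s t : ℝ) :
    rateGivenW lam (crossLaw α γ s t)
      = optRate lam fun x => ∑ u, ∑ v, crossLaw α γ s t u v x := by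
  -- Given `u`, the two possible inputs are merged by one pairing (giving `s + t` and 0) and
  -- separated by the other two.
  have hY : ∀ u, ∑ y, eta (outY (fun x => ∑ v, crossLaw α γ s t u v x) y)
      = crossWeight α γ u * ((eta (s + t) + 2 * eta s + 2 * eta t) / 3
          + Real.logb 2 3 * (s + t))
        + eta (crossWeight α γ u) * (s + t) := by
    intro u
    rw [sum_eta_outY]
    generalize hk : crossWeight α γ u = k
    fin_cases u <;>
    · simp at hk
      simp [crossLaw, hk, Fin.sum_univ_four, ← mul_add, eta_mul]
      ring
  have hUV : ∀ u, ∑ v, eta (∑ x, crossLaw α γ s t u v x)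
      = crossWeight α γ u * (eta s + eta t) + eta (crossWeight α γ u) * (s + t) := by
    intro u
    simp [crossLaw, Fin.sum_univ_two, eta_mul]
    ring
  have hVZ : ∑ v, ∑ z, eta (outZ (fun x => ∑ u, crossLaw α γ s t u v x) z)
      = eta s + eta t := by
    simp only [sum_eta_outZ]
    simp [crossLaw, crossWeight, Fin.sum_univ_two, Fin.sum_univ_four]
    ring_nf
  have hk : ∑ u, crossWeight α γ u = 1 := by
    simp [crossWeight, Fin.sum_univ_four]; ring
  have hZ : ∑ z, eta (outZ (fun x => ∑ u, ∑ v, crossLaw α γ s t u v x) z) = eta s + eta t := by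
    rw [sum_eta_outZ]
    simp only [sum_crossLaw]
    simp
    ring_nf
  have hX : ∑ x, ∑ u, ∑ v, crossLaw α γ s t u v x = s + t := by
    simp only [sum_crossLaw]
    simp [Fin.sum_univ_four]; ring
  simp only [rateGivenW, optRate, hY, hUV, hVZ, hZ, hX, Finset.sum_add_distrib,
    ← Finset.sum_mul, hk]
  ring

lemma exists_split {a b : ℝ} (ha : 0 ≤ a) (hb : 0 ≤ b) :
    ∃ α ∈ Set.Icc (0 : ℝ) 1, a = α * (a + b) ∧ b = (1 - α) * (a + b) := by
  rcases (add_nonneg ha hb).eq_or_lt with h | h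
  -- With zero total mass any ratio works.
  · exact ⟨0, by simp, by linarith, by linarith⟩
  · refine ⟨a / (a + b), ⟨by positivity, (div_le_one h).2 (by linarith)⟩, ?_, ?_⟩
    · field_simp
    · field_simp; ring

/-- `optRate` is achieved. -/
lemma exists_rateGivenW_eq (lam : ℝ) {μ : Fin 4 → ℝ} (hμ : ∀ x, 0 ≤ μ x) :
    ∃ m : Fin 4 → Fin 2 → Fin 4 → ℝ, (∀ u v x, 0 ≤ m u v x) ∧
      (∀ x, ∑ u, ∑ v, m u v x = μ x) ∧ rateGivenW lam m = optRate lam μ := by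
  obtain ⟨α, ⟨hα0, hα1⟩, ha, hb⟩ := exists_split (hμ 0) (hμ 1)
  obtain ⟨γ, ⟨hγ0, hγ1⟩, hc, hd⟩ := exists_split (hμ 2) (hμ 3)
  have hs := add_nonneg (hμ 0) (hμ 1)
  have ht := add_nonneg (hμ 2) (hμ 3)
  have hsum : ∀ x, ∑ u, ∑ v, crossLaw α γ (μ 0 + μ 1) (μ 2 + μ 3) u v x = μ x := by
    intro x
    rw [sum_crossLaw, ← ha, ← hb, ← hc, ← hd]
    fin_cases x <;> rfl
  refine ⟨crossLaw α γ (μ 0 + μ 1) (μ 2 + μ 3), fun u v x => ?_, hsum, ?_⟩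
  · refine mul_nonneg ?_ (by split_ifs <;> first | assumption | exact le_rfl)
    have := sub_nonneg.2 hα1
    have := sub_nonneg.2 hγ1
    fin_cases u <;> simp [crossWeight] <;> positivity
  · rw [rateGivenW_crossLaw]
    simp only [hsum]

/-- Homogeneity turns a sum over the masses of `W` into a convex combination of values on the
simplex. -/
lemma optRate_smul (lam c : ℝ) (μ : Fin 4 → ℝ) : optRate lam (c • μ) = c * optRate lam μ := by
  simp only [optRate, sum_eta_outY, sum_eta_outZ, Fin.sum_univ_four, Pi.smul_apply, smul_eq_mul,
    ← mul_add, eta_mul]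
  ring

lemma continuous_outY (y : Fin 6) : Continuous fun μ => outY μ y :=
  continuous_finsetSum _ fun x _ => by split_ifs <;> fun_prop

lemma continuous_outZ (z : Fin 2) : Continuous fun μ => outZ μ z :=
  continuous_finsetSum _ fun x _ => by split_ifs <;> fun_prop

lemma continuous_optRate (lam : ℝ) : Continuous (optRate lam) := by
  have h1 := fun y => continuous_eta.comp (continuous_outY y)
  have h2 := fun z => continuous_eta.comp (continuous_outZ z)
  have h3 : Continuous fun μ : Fin 4 → ℝ => eta (∑ x, μ x) :=
    continuous_eta.comp (by fun_prop)
  simp only [Function.comp_def] at h1 h2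
  unfold optRate
  fun_prop

/-! ### The `λ`-sum rate as a concave envelope -/

/-- Convex hull of the graph of `optRate` over the simplex. -/
def rateHull (lam : ℝ) : Set ((Fin 4 → ℝ) × ℝ) :=
  convexHull ℝ ((fun p => (p, optRate lam p)) '' stdSimplex ℝ (Fin 4))

lemma isCompact_rateHull (lam : ℝ) : IsCompact (rateHull lam) :=
  isCompact_convexHull_of_finiteDimensional <| (isCompact_stdSimplex ℝ (Fin 4)).image <|
    continuous_id.prodMk (continuous_optRate lam)

lemma mem_rateHull {lam : ℝ} {p : Fin 4 → ℝ} (hp : p ∈ stdSimplex ℝ (Fin 4)) :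
    (p, optRate lam p) ∈ rateHull lam :=
  subset_convexHull _ _ ⟨p, hp, rfl⟩

/-- Sums of `optRate` over a decomposition of `p` belong to the hull. -/
lemma sum_optRate_mem_rateHull {ι : Type} [Fintype ι] (lam : ℝ) {p : Fin 4 → ℝ}
    (hp : p ∈ stdSimplex ℝ (Fin 4)) (μ : ι → Fin 4 → ℝ) (hμ : ∀ i x, 0 ≤ μ i x)
    (hsum : ∑ i, μ i = p) : (p, ∑ i, optRate lam (μ i)) ∈ rateHull lam := by
  set c : ι → ℝ := fun i => ∑ x, μ i x with hc
  have hc0 : ∀ i, 0 ≤ c i := fun i => Finset.sum_nonneg fun x _ => hμ i x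
  have hex : ∀ i, ∃ q ∈ stdSimplex ℝ (Fin 4), c i • q = μ i := by
    intro i
    rcases (hc0 i).eq_or_lt with h | h
    -- A slice of mass zero has no conditional law; `p` serves as an arbitrary point of the simplex.
    · refine ⟨p, hp, ?_⟩
      funext x
      have := (Finset.sum_eq_zero_iff_of_nonneg fun x _ => hμ i x).1 h.symm x (Finset.mem_univ _)
      simp [← h, this]
    · refine ⟨(c i)⁻¹ • μ i, ⟨fun x => mul_nonneg (inv_nonneg.2 h.le) (hμ i x), ?_⟩, ?_⟩
      · simp only [Pi.smul_apply, smul_eq_mul, ← Finset.mul_sum]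
        exact inv_mul_cancel₀ h.ne'
      · rw [smul_smul, mul_inv_cancel₀ h.ne', one_smul]
  choose q hq hqμ using hex
  refine mem_convexHull_of_exists_fintype c (fun i => (q i, optRate lam (q i))) hc0 ?_
    (fun i => ⟨q i, hq i, rfl⟩) ?_
  · rw [← hp.2, ← hsum, hc, Finset.sum_comm]
    simp
  · refine Prod.ext ?_ ?_
    · simp [Prod.fst_sum, hqμ, hsum]
    · simp only [Prod.snd_sum, Prod.smul_mk, smul_eq_mul, ← optRate_smul, hqμ]

/-- Every achievable value is dominated by a point of the hull. -/
lemma exists_mem_rateHull_of_mem_sumRateValues {lam : ℝ} {p : Fin 4 → ℝ} {s : ℝ}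
    (hs : s ∈ sumRateValues semiDetChannel lam p) :
    ∃ t, (p, t) ∈ rateHull lam ∧ s ≤ outputEntropy lam p + t := by
  obtain ⟨k, l, n, r, ⟨hr0, hr1⟩, hp, rfl⟩ := hs
  change law r (fun ω => ω.2.2.2) = p at hp
  have hpX : ∀ x, p x = ∑ w, ∑ u, ∑ v, r (u, v, w, x) := by
    intro x
    rw [← hp, law_X]
    exact Finset.sum_comm_cycle (f := fun u v w => r (u, v, w, x))
  have hps : p ∈ stdSimplex ℝ (Fin 4) := by
    refine ⟨fun x => ?_, ?_⟩
    · rw [hpX]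
      exact Finset.sum_nonneg fun _ _ => Finset.sum_nonneg fun _ _ =>
        Finset.sum_nonneg fun _ _ => hr0 _
    · rw [← hr1, ← hp]
      simp only [law]
      rw [Finset.sum_comm]
      simp
  refine ⟨_, sum_optRate_mem_rateHull lam hps (fun w x => ∑ u, ∑ v, r (u, v, w, x))
    (fun w x => Finset.sum_nonneg fun _ _ => Finset.sum_nonneg fun _ _ => hr0 _) ?_, ?_⟩
  · funext x
    rw [hpX, Finset.sum_apply]
  · rw [sumRate_eq, hp]
    gcongr
    exact rateGivenW_le _ _ fun _ _ _ => hr0 _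

/-- Every point of the hull gives an achievable value. -/
lemma mem_sumRateValues_of_mem_rateHull {lam : ℝ} {p : Fin 4 → ℝ} {t : ℝ}
    (h : (p, t) ∈ rateHull lam) :
    outputEntropy lam p + t ∈ sumRateValues semiDetChannel lam p := by
  obtain ⟨ι, _, c, z, hc0, hc1, hz, hx⟩ := mem_convexHull_iff_exists_fintype.1 h
  choose q hq hqz using hz
  have hx1 : ∑ i, c i • q i = p := by
    have := congrArg Prod.fst hx
    simpa [Prod.fst_sum, ← hqz] using this
  have hx2 : ∑ i, optRate lam (c i • q i) = t := by
    have := congrArg Prod.snd hx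
    simpa [Prod.snd_sum, ← hqz, optRate_smul] using this
  have hμ : ∀ i x, 0 ≤ (c i • q i) x := fun i x => mul_nonneg (hc0 i) ((hq i).1 x)
  choose m hm0 hm1 hm2 using fun i => exists_rateGivenW_eq lam (hμ i)
  let e := Fintype.equivFin ι
  let r : Fin 4 × Fin 2 × Fin (Fintype.card ι) × Fin 4 → ℝ :=
    fun ω => m (e.symm ω.2.2.1) ω.1 ω.2.1 ω.2.2.2
  have hX : law r (fun ω => ω.2.2.2) = p := by
    rw [law_X, ← hx1]
    funext x
    rw [Finset.sum_comm_cycle, Finset.sum_apply]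
    simp only [r]
    rw [Equiv.sum_comp e.symm fun i => ∑ u, ∑ v, m i u v x]
    simp only [hm1]
  refine ⟨4, 2, Fintype.card ι, r, ⟨fun ω => hm0 _ _ _ _, ?_⟩, hX, ?_⟩
  · have h1 : ∑ x, p x = 1 := by
      rw [← hx1, ← hc1]
      simp only [Finset.sum_apply]
      rw [Finset.sum_comm]
      simp only [Pi.smul_apply, smul_eq_mul, ← Finset.mul_sum, (hq _).2, mul_one]
    rw [← h1, ← hX]
    simp only [law]
    rw [Finset.sum_comm]
    simp
  · rw [sumRate_eq, hX, ← hx2]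
    simp only [r]
    rw [Equiv.sum_comp e.symm fun i => rateGivenW lam fun u v x => m i u v x]
    exact congrArg _ (Finset.sum_congr rfl fun i _ => hm2 i)

/-- The fibre of the compact hull over `p` has a highest point; it is achievable, and every
achievable value lies below some point of that fibre. -/
lemma exists_isGreatest_sumRateValues (lam : ℝ) {p : Fin 4 → ℝ}
    (hp : p ∈ stdSimplex ℝ (Fin 4)) :
    ∃ t, (p, t) ∈ rateHull lam ∧ (∀ t', (p, t') ∈ rateHull lam → t' ≤ t) ∧
      IsGreatest (sumRateValues semiDetChannel lam p) (outputEntropy lam p + t) := by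
  have hK : IsCompact (rateHull lam ∩ {x | x.1 = p}) :=
    (isCompact_rateHull lam).inter_right (isClosed_eq continuous_fst continuous_const)
  obtain ⟨⟨p', t⟩, ⟨ht, rfl⟩, hmax⟩ :=
    hK.exists_isMaxOn ⟨(p, optRate lam p), mem_rateHull hp, rfl⟩ continuous_snd.continuousOn
  have hmax' : ∀ t', (p', t') ∈ rateHull lam → t' ≤ t := fun t' ht' => hmax ⟨ht', rfl⟩
  refine ⟨t, ht, hmax', mem_sumRateValues_of_mem_rateHull ht, fun s hs => ?_⟩
  obtain ⟨t', ht', hs'⟩ := exists_mem_rateHull_of_mem_sumRateValues hs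
  exact hs'.trans (by gcongr; exact hmax' t' ht')

lemma exists_lambdaSR_eq (lam : ℝ) {p : Fin 4 → ℝ} (hp : p ∈ stdSimplex ℝ (Fin 4)) :
    ∃ t, (p, t) ∈ rateHull lam ∧ (∀ t', (p, t') ∈ rateHull lam → t' ≤ t) ∧
      lambdaSR semiDetChannel lam p = outputEntropy lam p + t := by
  obtain ⟨t, ht, hmax, hg⟩ := exists_isGreatest_sumRateValues lam hp
  exact ⟨t, ht, hmax, hg.csSup_eq⟩

/-! ### Concavity -/

lemma concaveOn_outputEntropy {lam : ℝ} (h0 : 0 ≤ lam) (h1 : lam ≤ 1) :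
    ConcaveOn ℝ (stdSimplex ℝ (Fin 4)) (outputEntropy lam) := by
  have hcvx := convex_stdSimplex ℝ (Fin 4)
  have hY : ∀ y, ConcaveOn ℝ (stdSimplex ℝ (Fin 4)) fun p => eta (outY p y) := by
    refine fun y => ⟨hcvx, fun p hp q hq a b ha hb hab => ?_⟩
    have : outY (a • p + b • q) y = a • outY p y + b • outY q y := by
      simp only [outY, smul_eq_mul, Finset.mul_sum, ← Finset.sum_add_distrib]
      refine Finset.sum_congr rfl fun x _ => ?_
      split_ifs <;> simp; ring
    simp only [this]
    exact concaveOn_eta.2 (outY_nonneg hp.1 y) (outY_nonneg hq.1 y) ha hb hab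
  have hZ : ∀ z, ConcaveOn ℝ (stdSimplex ℝ (Fin 4)) fun p => eta (outZ p z) := by
    refine fun z => ⟨hcvx, fun p hp q hq a b ha hb hab => ?_⟩
    have : outZ (a • p + b • q) z = a • outZ p z + b • outZ q z := by
      simp only [outZ, smul_eq_mul, Finset.mul_sum, ← Finset.sum_add_distrib]
      refine Finset.sum_congr rfl fun x _ => ?_
      split_ifs <;> simp
    simp only [this]
    exact concaveOn_eta.2 (outZ_nonneg hp.1 z) (outZ_nonneg hq.1 z) ha hb hab
  refine ⟨hcvx, fun p hp q hq a b ha hb hab => ?_⟩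
  have hYs := Finset.sum_le_sum fun y (_ : y ∈ Finset.univ) => (hY y).2 hp hq ha hb hab
  have hZs := Finset.sum_le_sum fun z (_ : z ∈ Finset.univ) => (hZ z).2 hp hq ha hb hab
  simp only [smul_eq_mul, Finset.sum_add_distrib, ← Finset.mul_sum] at hYs hZs
  have := mul_le_mul_of_nonneg_left hYs h0
  have := mul_le_mul_of_nonneg_left hZs (sub_nonneg.2 h1)
  simp only [outputEntropy, smul_eq_mul]
  linarith

/-- Mixing the top points over `p` and `q` stays in the convex hull, hence below the top point over
the mixture; `outputEntropy` is concave separately. -/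
lemma concaveOn_lambdaSR {lam : ℝ} (h0 : 0 ≤ lam) (h1 : lam ≤ 1) :
    ConcaveOn ℝ (stdSimplex ℝ (Fin 4)) fun p => lambdaSR semiDetChannel lam p := by
  have hcvx := convex_stdSimplex ℝ (Fin 4)
  refine ⟨hcvx, fun p hp q hq a b ha hb hab => ?_⟩
  obtain ⟨s, hs, -, hps⟩ := exists_lambdaSR_eq lam hp
  obtain ⟨t, ht, -, hqt⟩ := exists_lambdaSR_eq lam hq
  obtain ⟨_, -, hmax, he⟩ := exists_lambdaSR_eq lam (hcvx hp hq ha hb hab)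
  have h2 := hmax _ (convex_convexHull ℝ _ hs ht ha hb hab)
  have h3 := (concaveOn_outputEntropy h0 h1).2 hp hq ha hb hab
  simp only [Prod.smul_snd, smul_eq_mul] at h2 h3
  simp only [smul_eq_mul, hps, hqt, he]
  linarith

/-! ### Values at the uniform distribution -/

lemma eta_add_eta_nonneg {x y : ℝ} (hx : 0 ≤ x) (hy : 0 ≤ y) (h : x + y = 1) :
    0 ≤ eta x + eta y := by
  have := eta_sum_le Finset.univ ![x, y] (by intro i _; fin_cases i <;> assumption)
  simpa [Fin.sum_univ_two, h] using this

lemma eta_add_eta_le_one {x y : ℝ} (hx : 0 ≤ x) (hy : 0 ≤ y) (h : x + y = 1) :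
    eta x + eta y ≤ 1 := by
  have := concaveOn_eta.2 hx hy (one_half_pos (α := ℝ)).le one_half_pos.le (add_halves 1)
  simp only [smul_eq_mul, ← mul_add, h, mul_one, eta_one_half] at this
  linarith

/-- The maximal value of the `λ`-sum rate. -/
def maxRate (lam : ℝ) : ℝ := 1 + max (2 * (1 - lam)) 1 / 3

lemma outputEntropy_le {lam : ℝ} (h0 : 0 ≤ lam) (h1 : lam ≤ 1) {p : Fin 4 → ℝ}
    (hp : p ∈ stdSimplex ℝ (Fin 4)) : outputEntropy lam p ≤ 1 + lam * Real.logb 2 3 := by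
  obtain ⟨hp0, hp1⟩ := hp
  have hs := hp1
  rw [Fin.sum_univ_four] at hs
  have a := eta_add_eta_le_one (add_nonneg (hp0 0) (hp0 1)) (add_nonneg (hp0 2) (hp0 3))
    (by linarith)
  have b := eta_add_eta_le_one (add_nonneg (hp0 0) (hp0 2)) (add_nonneg (hp0 1) (hp0 3))
    (by linarith)
  have c := eta_add_eta_le_one (add_nonneg (hp0 0) (hp0 3)) (add_nonneg (hp0 1) (hp0 2))
    (by linarith)
  rw [outputEntropy, sum_eta_outY, sum_eta_outZ, hp1]
  have h1' := sub_nonneg.2 h1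
  have := mul_le_mul_of_nonneg_left a h1'
  have := mul_le_mul_of_nonneg_left (add_le_add (add_le_add a b) c) h0
  linarith

lemma optRate_le {lam : ℝ} (h1 : lam ≤ 1) {p : Fin 4 → ℝ}
    (hp : p ∈ stdSimplex ℝ (Fin 4)) :
    optRate lam p ≤ max (2 * (1 - lam)) 1 / 3 - lam * Real.logb 2 3 := by
  obtain ⟨hp0, hp1⟩ := hp
  have hs := hp1
  rw [Fin.sum_univ_four] at hs
  have a := eta_add_eta_le_one (add_nonneg (hp0 0) (hp0 1)) (add_nonneg (hp0 2) (hp0 3))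
    (by linarith)
  have a' := eta_add_eta_nonneg (add_nonneg (hp0 0) (hp0 1)) (add_nonneg (hp0 2) (hp0 3))
    (by linarith)
  have b := eta_add_eta_le_one (add_nonneg (hp0 0) (hp0 2)) (add_nonneg (hp0 1) (hp0 3))
    (by linarith)
  have c := eta_add_eta_le_one (add_nonneg (hp0 0) (hp0 3)) (add_nonneg (hp0 1) (hp0 2))
    (by linarith)
  rw [optRate, sum_eta_outY, sum_eta_outZ, hp1, eta_one]
  have h1' := sub_nonneg.2 h1
  have hbc := mul_le_mul_of_nonneg_left (add_le_add b c) h1'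
  -- In `optRate` the entropy h₁ of `Z` has coefficient (2λ - 1)/3, so its sign decides whether h₁ ≥
  -- 0 or h₁ ≤ 1 is the relevant bound.
  rcases le_total (2 * lam) 1 with h | h
  · have := mul_nonneg (sub_nonneg.2 h) a'
    have := le_max_left (2 * (1 - lam)) 1
    linarith
  · have := mul_le_mul_of_nonneg_left a (sub_nonneg.2 h)
    have := le_max_right (2 * (1 - lam)) 1
    linarith

lemma lambdaSR_le {lam : ℝ} (h0 : 0 ≤ lam) (h1 : lam ≤ 1) {p : Fin 4 → ℝ}
    (hp : p ∈ stdSimplex ℝ (Fin 4)) : lambdaSR semiDetChannel lam p ≤ maxRate lam := by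
  obtain ⟨t, ht, -, he⟩ := exists_lambdaSR_eq lam hp
  -- A bound on the height of the graph is a half-space condition, so it passes to the convex hull.
  have hsub : rateHull lam ⊆
      {x | x.2 ≤ max (2 * (1 - lam)) 1 / 3 - lam * Real.logb 2 3} := by
    refine convexHull_min ?_ (convex_halfSpace_le (LinearMap.snd ℝ _ ℝ).isLinear _)
    rintro _ ⟨q, hq, rfl⟩
    exact optRate_le h1 hq
  have := hsub ht
  have := outputEntropy_le h0 h1 hp
  simp only [Set.mem_ofPred_eq] at *
  rw [he, maxRate]
  linarith

lemma uniformInput_mem : uniformInput ∈ stdSimplex ℝ (Fin 4) :=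
  ⟨fun _ => by norm_num [uniformInput], by norm_num [uniformInput]⟩

lemma outputEntropy_uniformInput (lam : ℝ) :
    outputEntropy lam uniformInput = 1 + lam * Real.logb 2 3 := by
  rw [outputEntropy, sum_eta_outY, sum_eta_outZ, uniformInput_mem.2]
  simp only [uniformInput]
  norm_num [eta_one_half]
  ring

lemma maxRate_le_lambdaSR_uniformInput (lam : ℝ) :
    maxRate lam ≤ lambdaSR semiDetChannel lam uniformInput := by
  obtain ⟨t, -, hmax, he⟩ := exists_lambdaSR_eq lam uniformInput_mem
  -- Constant `W`: all three pairings of the uniform law are fair bits.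
  have h1 : 1 / 3 - lam * Real.logb 2 3 ≤ t := by
    refine le_of_eq_of_le ?_ (hmax _ (mem_rateHull uniformInput_mem))
    rw [optRate, sum_eta_outY, sum_eta_outZ, uniformInput_mem.2]
    simp only [uniformInput]
    norm_num [eta_one_half]
    ring
  -- `W = Z`: on each half `Z` is constant, while the other two pairings remain fair bits.
  have h2 : 2 * (1 - lam) / 3 - lam * Real.logb 2 3 ≤ t := by
    refine le_of_eq_of_le ?_ (hmax _ (sum_optRate_mem_rateHull lam uniformInput_mem
      ![![1 / 4, 1 / 4, 0, 0], ![0, 0, 1 / 4, 1 / 4]] ?_ ?_))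
    · have e : eta (1 / 4) = 1 / 2 := by
        rw [show (1 / 4 : ℝ) = 1 / 2 * (1 / 2) by norm_num, eta_mul, eta_one_half]; norm_num
      rw [Fin.sum_univ_two]
      simp only [optRate, sum_eta_outY, sum_eta_outZ, Fin.sum_univ_four]
      simp
      norm_num [eta_one_half, e]
      ring
    · intro i x
      fin_cases i <;> fin_cases x <;> norm_num
    · funext x
      fin_cases x <;> simp [uniformInput]
  rw [he, outputEntropy_uniformInput, maxRate]
  rcases max_choice (2 * (1 - lam)) 1 with h | h <;> rw [h] <;> linarith

lemma lambdaSR_uniformInput {lam : ℝ} (h0 : 0 ≤ lam) (h1 : lam ≤ 1) :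
    lambdaSR semiDetChannel lam uniformInput = maxRate lam :=
  (lambdaSR_le h0 h1 uniformInput_mem).antisymm (maxRate_le_lambdaSR_uniformInput lam)

end

end BC

theorem mainTheorem9 (lam : ℝ) (hlam : lam ∈ Set.Icc (0 : ℝ) 1) :
    (∀ p ∈ stdSimplex ℝ (Fin 4),
      IsGreatest (BC.sumRateValues BC.semiDetChannel lam p)
        (BC.lambdaSR BC.semiDetChannel lam p)) ∧
    ConcaveOn ℝ (stdSimplex ℝ (Fin 4)) (fun p => BC.lambdaSR BC.semiDetChannel lam p) ∧
    BC.uniformInput ∈ stdSimplex ℝ (Fin 4) ∧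
    (∀ p ∈ stdSimplex ℝ (Fin 4),
      BC.lambdaSR BC.semiDetChannel lam p ≤
        BC.lambdaSR BC.semiDetChannel lam BC.uniformInput) ∧
    (lam ≤ 1 / 2 →
      BC.lambdaSR BC.semiDetChannel lam BC.uniformInput = 5 / 3 - 2 * lam / 3) ∧
    (1 / 2 ≤ lam →
      BC.lambdaSR BC.semiDetChannel lam BC.uniformInput = 4 / 3) := by
  obtain ⟨h0, h1⟩ := hlam
  refine ⟨fun p hp => ?_, BC.concaveOn_lambdaSR h0 h1, BC.uniformInput_mem, fun p hp => ?_,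
    fun h => ?_, fun h => ?_⟩
  · obtain ⟨t, -, -, hg⟩ := BC.exists_isGreatest_sumRateValues lam hp
    rwa [BC.lambdaSR, hg.csSup_eq]
  · rw [BC.lambdaSR_uniformInput h0 h1]
    exact BC.lambdaSR_le h0 h1 hp
  · rw [BC.lambdaSR_uniformInput h0 h1, BC.maxRate, max_eq_left (by linarith)]
    ring
  · rw [BC.lambdaSR_uniformInput h0 h1, BC.maxRate, max_eq_right (by linarith)]
    norm_num
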